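/- For an integer $L\ge 1$ write $\lambda(L)$ for Carmichael's function and, for a prime $p$, let $L_{(p)}$ be the product of the primes $q\mid L$ with $p\mid q-1$. Fix reals $\delta>0$ and $K$. Consider an integer $y_5$, positive reals $y_1,y_2,y_3,y_4$, a positive integer $w$ and a square-free positive integer $L$ such that: - each ratio $\log b/\log a$ of consecutive terms $a,b$ of the sequence $y_1,y_2,w,y_3,y_4,y_5$ lies in $[1+\delta,10]$, and $y_2=y_5^{1/6-1/500}$; - $\omega(L)\ge y_4$; $q-1$ is square-free for every prime $q\mid L$; $L_{(p)}>1$ only for $p=2$ or $p\in[y_3,y_5]$; $\omega(L_{(p)})\le y_1$ for every prime $p>2$; the number of primes $p$ with $L_{(p)}>1$ is at most $Ky_2$; and $3$ is a quadratic residue modulo $L$. Put $x=y_5^{\,w/(1/6-3/1000)}$ and $r=\lfloor y_5^{\sqrt{y_2w}}\rfloor$, let $\mathcal D$ be the set of divisors of $L$ with exactly $w$ prime factors, let $\mathcal D'$ be the set of those $d\in\mathcal D$ that are divisible by no member of a given finite set of (exceptional) non-negative integers, let $k<x$ be a non-negative integer prime to $L$, and let $\mathcal P$ be the set of primes of the form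 $dk+1$ with $d\in\mathcal D'$. Suppose that $k$ has been chosen so that $|\mathcal P|\ge|\mathcal D|/(4\log x)$ and so that, for every coset of a proper subgroup of odd index of $(\mathbb Z/L\mathbb Z)^\times$, there are fewer than $|\mathcal D|/(\log x\log\log x)$ elements $d\in\mathcal D'$ for which $dk+1$ is a prime lying in that coset modulo $L$. **Proposition.** For all reals $\delta>0$, $K$, $C$ and $\varepsilon>0$ there is $Y$ such that the following holds for all data as above with $y_5\ge Y$. Let $h$ be a positive integer with $h\le C\lambda(L)^2$, let $a$ be an integer such that the progression $a \bmod h$ contains an even number, and let $\square$ be an invertible square modulo $L$. Then for all but at most $\varepsilon\binom{|\mathcal P|}{r}$ of the $r$-element subsets $\mathcal P^\star\subset\mathcal P$ there is a square-free integer $N>1$ such that all prime factors of $N$ lie in $\mathcal P^\star$, $N\equiv\square\pmod L$, $\omega(N)\equiv a\pmod h$, and $\omega(N)$ is even. -/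

import Mathlib

open scoped Pointwise

noncomputable section

namespace CarmichaelConstruction

/-- A finite sequence of positive reals is logarithmically spread, with lower margin `δ`, if the
ratio of the logarithms of any two consecutive terms lies between `1 + δ` and `10`. -/
def LogSpread (δ : ℝ) (l : List ℝ) : Prop :=
  (∀ a ∈ l, 0 < a) ∧
    l.IsChain (fun a b => 1 + δ ≤ Real.log b / Real.log a ∧ Real.log b / Real.log a ≤ 10)

/-- `L_(p)`: the product of those primes `q` with `q ∣ L` and `p ∣ q - 1`. -/
def part (L p : ℕ) : ℕ := ∏ q ∈ L.primeFactors with p ∣ q - 1, q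

/-- The parameters of the construction. The members of `E` are the exceptional moduli: divisors
of `L` that are divisible by one of them are discarded. -/
structure Params where
  y₁ : ℝ
  y₂ : ℝ
  y₃ : ℝ
  y₄ : ℝ
  y₅ : ℕ
  w : ℕ
  L : ℕ
  E : Finset ℕ
  k : ℕ

namespace Params

variable (c : Params)

/-- The defining properties of `y₁, …, y₅, w` and `L`; `δ` is the margin in the logarithmic
spread and `K` the constant in the bound `O(y₂)`. -/
structure IsModulus (δ K : ℝ) : Prop where
  w_pos : 0 < c.w
  spread : LogSpread δ [c.y₁, c.y₂, (c.w : ℝ), c.y₃, c.y₄, (c.y₅ : ℝ)]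
  y₂_eq : c.y₂ = (c.y₅ : ℝ) ^ (1 / 6 - 1 / 500 : ℝ)
  squarefree : Squarefree c.L
  omega_ge : c.y₄ ≤ (ArithmeticFunction.cardDistinctFactors c.L : ℝ)
  pred_squarefree : ∀ q ∈ c.L.primeFactors, Squarefree (q - 1)
  part_range : ∀ p : ℕ, p.Prime → 1 < part c.L p →
    p = 2 ∨ (c.y₃ ≤ (p : ℝ) ∧ (p : ℝ) ≤ (c.y₅ : ℝ))
  part_omega : ∀ p : ℕ, p.Prime → 2 < p →
    (ArithmeticFunction.cardDistinctFactors (part c.L p) : ℝ) ≤ c.y₁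
  part_count : (Set.ncard {p : ℕ | p.Prime ∧ 1 < part c.L p} : ℝ) ≤ K * c.y₂
  three_coprime : Nat.Coprime 3 c.L
  three_isSquare : IsSquare (3 : ZMod c.L)

/-- `𝓓`: the divisors of `L` with exactly `w` prime factors. -/
def D : Finset ℕ := {d ∈ c.L.divisors | ArithmeticFunction.cardDistinctFactors d = c.w}

/-- `𝓓'`: the members of `𝓓` that are divisible by no exceptional modulus. -/
def D' : Finset ℕ := {d ∈ c.D | ∀ e ∈ c.E, ¬ e ∣ d}

/-- The height `x = y₅ ^ (w / (1/6 - 3/1000))`. -/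
def x : ℝ := (c.y₅ : ℝ) ^ ((c.w : ℝ) / (1 / 6 - 3 / 1000))

/-- The set of primes `𝓟 = {dk + 1 prime : d ∈ 𝓓'}`. -/
def P : Finset ℕ := {p ∈ c.D'.image (fun d => d * c.k + 1) | p.Prime}

open Classical in
/-- The multipliers `k` (to be avoided) for which some coset of a proper subgroup of odd index of
`(ℤ/Lℤ)ˣ` contains the primes `dk + 1` for at least `|𝓓| / (log x log log x)` values of
`d ∈ 𝓓'`. -/
def badMultipliers : Set ℕ :=
  {k | ∃ H : Subgroup (ZMod c.L)ˣ, H ≠ ⊤ ∧ Odd H.index ∧ ∃ g : (ZMod c.L)ˣ,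
    (c.D.card : ℝ) / (Real.log c.x * Real.log (Real.log c.x)) ≤
      (Finset.card {d ∈ c.D' | (d * k + 1).Prime ∧
        ∃ u ∈ g • (H : Set (ZMod c.L)ˣ), (u : ZMod c.L) = ((d * k + 1 : ℕ) : ZMod c.L)} : ℝ)}

/-- The parameters come from the construction: `y₁, …, y₅, w, L` have the required properties,
and `k < x` is a multiplier prime to `L`, not a bad one, for which there are at least
`|𝓓| / (4 log x)` primes `dk + 1` with `d ∈ 𝓓'`. -/
structure IsConstruction (δ K : ℝ) : Prop extends c.IsModulus δ K where
  k_lt : (c.k : ℝ) < c.x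
  k_coprime : Nat.Coprime c.k c.L
  k_good : c.k ∉ c.badMultipliers
  card_P : (c.D.card : ℝ) / (4 * Real.log c.x) ≤ (c.P.card : ℝ)

/-- The size `r = ⌊y₅ ^ √(y₂ w)⌋` of the random subsets of `𝓟`. -/
def r : ℕ := ⌊(c.y₅ : ℝ) ^ Real.sqrt (c.y₂ * (c.w : ℝ))⌋₊

end Params

/-- `N > 1` is a product of distinct elements of the set `S` of primes with `N ≡ u (mod L)`,
`ω(N) ≡ a (mod h)` and `ω(N)` even. -/
structure IsTarget (L h : ℕ) (a : ℤ) (u : (ZMod L)ˣ) (S : Finset ℕ) (N : ℕ) : Prop where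
  one_lt : 1 < N
  squarefree : Squarefree N
  primeFactors_subset : ∀ p : ℕ, p.Prime → p ∣ N → p ∈ S
  residue : (N : ZMod L) = (u : ZMod L)
  omega_modEq : (ArithmeticFunction.cardDistinctFactors N : ℤ) ≡ a [ZMOD (h : ℤ)]
  omega_even : Even (ArithmeticFunction.cardDistinctFactors N)

end CarmichaelConstruction

end

namespace CarmichaelConstruction

/-! Write `□ = v²` and `a ≡ 2b (mod h)`. A target `N` is a nonempty set of primes whose images `(p,
1)` in `G = (ℤ/L)ˣ × ℤ/2h` sum to `2 • (v, b)`; the modulus `2h` also forces parity. Such sets are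
counted by orthogonality of characters (`exists_subset_sum_eq`). Quadratic characters contribute
nonnegative reals because the target is a double. Any other character contributes little once it is
nontrivial at a fixed proportion of the primes.

That proportion comes from balance: no coset of a proper subgroup `{χ² = 1}` of `(ℤ/L)ˣ` contains
half of the primes (`Balanced.char_dichotomy`). Every `q - 1` divides `2m` with `m` odd, so these
subgroups have odd index, and the choice of `k` leaves at most `1/16` of `𝓟` in each coset. Hence a
given coset spoils at most a proportion `2 ^ (-r)` of the `r`-subsets, and there are at most `L²`
pairs of a character and a coset representative. The size `r` beats every fixed multiple of `m ^ 8`,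
which absorbs `L ≤ exp (4m²)`, `h = O(m²)` and the exponent of `G`. -/

/-! ### Random subsets and a sparse set. -/

theorem pow_mul_descFactorial_le {c a p : ℕ} (h : c * a ≤ p) (t : ℕ) :
    c ^ t * a.descFactorial t ≤ p.descFactorial t := by
  rcases Nat.eq_zero_or_pos c with rfl | hc
  · rcases Nat.eq_zero_or_pos t with rfl | ht
    · simp
    · simp [ht.ne']
  induction t with
  | zero => simp
  | succ t ih =>
    rw [Nat.descFactorial_succ, Nat.descFactorial_succ, pow_succ]
    have h1 : c * (a - t) ≤ p - t := by
      rw [Nat.mul_sub]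
      have : t ≤ c * t := Nat.le_mul_of_pos_left t hc
      omega
    calc c ^ t * c * ((a - t) * a.descFactorial t)
        = (c * (a - t)) * (c ^ t * a.descFactorial t) := by ring
      _ ≤ _ := Nat.mul_le_mul h1 ih

theorem pow_mul_choose_le {c a p : ℕ} (h : c * a ≤ p) (t : ℕ) :
    c ^ t * a.choose t ≤ p.choose t := by
  have h1 := pow_mul_descFactorial_le h t
  rw [Nat.descFactorial_eq_factorial_mul_choose, Nat.descFactorial_eq_factorial_mul_choose,
    Nat.mul_left_comm] at h1
  exact Nat.le_of_mul_le_mul_left h1 t.factorial_pos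

/-- The number of `r`-subsets of `P` that meet `A` in at least `t` elements. -/
theorem card_filter_le_card_inter {α : Type*} [DecidableEq α] {P A : Finset α} (hA : A ⊆ P)
    {r t : ℕ} :
    (Finset.card {S ∈ P.powersetCard r | t ≤ (S ∩ A).card}) ≤
      A.card.choose t * (P.card - t).choose (r - t) := by
  -- Choose `t` elements of `S ∩ A`, then the other `r - t` freely; overcounting is harmless.
  have hsub : ({S ∈ P.powersetCard r | t ≤ (S ∩ A).card} : Finset (Finset α)) ⊆
      (A.powersetCard t).biUnion (fun T => ((P \ T).powersetCard (r - t)).image (T ∪ ·)) := by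
    intro S hS
    rw [Finset.mem_filter, Finset.mem_powersetCard] at hS
    obtain ⟨⟨hSP, hSr⟩, ht⟩ := hS
    obtain ⟨T, hT, hTc⟩ := Finset.exists_subset_card_eq ht
    have hTS : T ⊆ S := hT.trans Finset.inter_subset_left
    simp only [Finset.mem_biUnion, Finset.mem_powersetCard, Finset.mem_image]
    refine ⟨T, ⟨hT.trans Finset.inter_subset_right, hTc⟩, S \ T, ⟨?_, ?_⟩, ?_⟩
    · exact Finset.sdiff_subset_sdiff hSP le_rfl
    · rw [Finset.card_sdiff_of_subset hTS, hSr, hTc]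
    · exact Finset.union_sdiff_of_subset hTS
  refine (Finset.card_le_card hsub).trans ?_
  refine (Finset.card_biUnion_le_card_mul _ _ ((P.card - t).choose (r - t)) ?_).trans ?_
  · intro T hT
    rw [Finset.mem_powersetCard] at hT
    refine Finset.card_image_le.trans ?_
    rw [Finset.card_powersetCard, Finset.card_sdiff_of_subset (hT.1.trans hA), hT.2]
  · rw [Finset.card_powersetCard]

/-- If `A` has density at most `1/16` in `P`, then at most a proportion `2 ^ (-r)` of the
`r`-subsets of `P` have half of their elements in `A`. -/
theorem card_half_inter_mul_two_pow_le {α : Type*} [DecidableEq α] {P A : Finset α}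
    (hA : A ⊆ P) (h16 : 16 * A.card ≤ P.card) (r : ℕ) :
    (Finset.card {S ∈ P.powersetCard r | r ≤ 2 * (S ∩ A).card}) * 2 ^ r ≤
      (P.powersetCard r).card := by
  set t := (r + 1) / 2 with ht
  have htr : t ≤ r := by omega
  have hrt : r ≤ 2 * t := by omega
  have h1 : (Finset.card {S ∈ P.powersetCard r | r ≤ 2 * (S ∩ A).card}) ≤
      A.card.choose t * (P.card - t).choose (r - t) := by
    refine le_trans (Finset.card_le_card ?_) (card_filter_le_card_inter hA)
    intro S hS
    rw [Finset.mem_filter] at hS ⊢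
    exact ⟨hS.1, by omega⟩
  rw [Finset.card_powersetCard]
  have h2 := pow_mul_choose_le h16 t
  have h3 : P.card.choose r * r.choose t = P.card.choose t * (P.card - t).choose (r - t) :=
    Nat.choose_mul htr
  have h4 : r.choose t ≤ 2 ^ r := Nat.choose_le_two_pow r t
  -- One factor `2 ^ r` pays for `r.choose t`; the other is the saving claimed.
  have h5 : 2 ^ r * 2 ^ r ≤ 16 ^ t := by
    calc 2 ^ r * 2 ^ r = 2 ^ (2 * r) := by rw [← pow_add]; congr 1; ring
      _ ≤ 2 ^ (4 * t) := Nat.pow_le_pow_right (by norm_num) (by omega)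
      _ = 16 ^ t := by rw [pow_mul]; norm_num
  set B := (Finset.card {S ∈ P.powersetCard r | r ≤ 2 * (S ∩ A).card})
  refine Nat.le_of_mul_le_mul_right (c := 2 ^ r) ?_ (by positivity)
  calc B * 2 ^ r * 2 ^ r = B * (2 ^ r * 2 ^ r) := by ring
    _ ≤ (A.card.choose t * (P.card - t).choose (r - t)) * 16 ^ t := Nat.mul_le_mul h1 h5
    _ = (16 ^ t * A.card.choose t) * (P.card - t).choose (r - t) := by ring
    _ ≤ P.card.choose t * (P.card - t).choose (r - t) := Nat.mul_le_mul_right _ h2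
    _ = P.card.choose r * r.choose t := h3.symm
    _ ≤ P.card.choose r * 2 ^ r := Nat.mul_le_mul_left _ h4

/-! ### Roots of unity and subset sums. -/

/-- The powers of `z` sum to zero, so `n = ∑ (1 - z ^ i)`, and each term has norm at most `n * ‖1 -
z‖`. -/
theorem norm_one_sub_ge_of_pow_eq_one {z : ℂ} {n : ℕ} (hn : 0 < n) (hz : z ^ n = 1)
    (h1 : z ≠ 1) : (1 : ℝ) / n ≤ ‖1 - z‖ := by
  have hn0 : (0 : ℝ) < n := by exact_mod_cast hn
  have hnorm : ‖z‖ = 1 := Complex.norm_eq_one_of_pow_eq_one hz hn.ne'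
  have hgeom : ∑ i ∈ Finset.range n, z ^ i = 0 := by
    rw [geom_sum_eq h1, hz, sub_self, zero_div]
  have hterm : ∀ i : ℕ, ‖1 - z ^ i‖ ≤ i * ‖1 - z‖ := by
    intro i
    induction i with
    | zero => simp
    | succ i ih =>
      have : 1 - z ^ (i + 1) = (1 - z ^ i) + z ^ i * (1 - z) := by ring
      rw [this]
      refine (norm_add_le _ _).trans ?_
      rw [norm_mul, norm_pow, hnorm, one_pow, one_mul]
      push_cast
      linarith
  have hsum : (n : ℂ) = ∑ i ∈ Finset.range n, (1 - z ^ i) := by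
    rw [Finset.sum_sub_distrib, hgeom]; simp
  have hle : (n : ℝ) ≤ n * (n * ‖1 - z‖) := by
    calc (n : ℝ) = ‖(n : ℂ)‖ := by simp
      _ ≤ ∑ i ∈ Finset.range n, ‖1 - z ^ i‖ := by rw [hsum]; exact norm_sum_le _ _
      _ ≤ ∑ i ∈ Finset.range n, (n : ℝ) * ‖1 - z‖ := by
          refine Finset.sum_le_sum fun i hi => (hterm i).trans ?_
          have : (i : ℝ) ≤ n := by exact_mod_cast (Finset.mem_range.1 hi).le
          gcongr
      _ = _ := by simp
  rw [div_le_iff₀ hn0, mul_comm]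
  exact le_of_mul_le_mul_left (by linarith) hn0

/-- By the parallelogram law, `‖1 + z‖² = 4 - ‖1 - z‖² ≤ 4 (1 - 1/(4n²))`. -/
theorem norm_one_add_le_of_pow_eq_one {z : ℂ} {n : ℕ} (hn : 0 < n) (hz : z ^ n = 1)
    (h1 : z ≠ 1) : ‖1 + z‖ ≤ 2 * Real.exp (-(1 / (8 * (n : ℝ) ^ 2))) := by
  have hnorm : ‖z‖ = 1 := Complex.norm_eq_one_of_pow_eq_one hz hn.ne'
  have hpar := parallelogram_law_with_norm ℝ (1 : ℂ) z
  have hlow := norm_one_sub_ge_of_pow_eq_one hn hz h1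
  rw [hnorm, norm_one] at hpar
  have hsq : ‖1 - z‖ ^ 2 ≥ (1 / (n : ℝ)) ^ 2 := pow_le_pow_left₀ (by positivity) hlow 2
  have hexp := Real.add_one_le_exp (-(1 / (4 * (n : ℝ) ^ 2)))
  have he2 : Real.exp (-(1 / (8 * (n : ℝ) ^ 2))) ^ 2 = Real.exp (-(1 / (4 * (n : ℝ) ^ 2))) := by
    rw [← Real.exp_nat_mul]; congr 1; push_cast; ring
  refine (abs_le_of_sq_le_sq' ?_ (by positivity)).2
  rw [mul_pow, he2]
  have h4 : (1 / (n : ℝ)) ^ 2 = 4 * (1 / (4 * (n : ℝ) ^ 2)) := by ring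
  nlinarith

theorem addChar_map_sum {G R ι : Type*} [AddCommMonoid G] [CommMonoid R] (χ : AddChar G R)
    (S : Finset ι) (f : ι → G) : χ (∑ s ∈ S, f s) = ∏ s ∈ S, χ (f s) := by
  classical
  induction S using Finset.induction_on with
  | empty => simp
  | insert a S ha ih =>
    rw [Finset.sum_insert ha, Finset.prod_insert ha, χ.map_add_eq_mul, ih]

/-- A subset-sum criterion in a finite abelian group: every character is either quadratic or
nontrivial on at least `M` terms of the sequence, and the target is divisible by two. -/
theorem exists_subset_sum_eq {G ι : Type*} [AddCommGroup G] [Fintype G] [DecidableEq ι]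
    (S : Finset ι) (f : ι → G) (g : G) {n M : ℕ} (hn : 0 < n) (hexp : ∀ x : G, n • x = 0)
    (hχ : ∀ χ : AddChar G ℂ, (∀ x, χ x ^ 2 = 1) ∨
      M ≤ (Finset.card {s ∈ S | χ (f s) ≠ 1}))
    (hM : 2 * (Fintype.card G : ℝ) ≤ Real.exp (M / (8 * (n : ℝ) ^ 2)))
    (hS : 2 * (Fintype.card G : ℝ) < 2 ^ S.card) :
    ∃ T ⊆ S, T.Nonempty ∧ ∑ s ∈ T, f s = 2 • g := by
  classical
  set A : Finset (Finset ι) := {T ∈ S.powerset | ∑ s ∈ T, f s = 2 • g} with hA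
  -- Two solutions are needed, as the empty set is one when `2 • g = 0`.
  suffices hcard : 1 < A.card by
    obtain ⟨T, hT, hT0⟩ := Finset.exists_mem_ne hcard ∅
    rw [hA, Finset.mem_filter, Finset.mem_powerset] at hT
    exact ⟨T, hT.1, Finset.nonempty_iff_ne_empty.2 hT0, hT.2⟩
  have hcount : (Fintype.card G : ℂ) * A.card =
      ∑ χ : AddChar G ℂ, χ (-(2 • g)) * ∏ s ∈ S, (1 + χ (f s)) := by
    have : ∀ χ : AddChar G ℂ, χ (-(2 • g)) * ∏ s ∈ S, (1 + χ (f s)) =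
        ∑ T ∈ S.powerset, χ ((∑ s ∈ T, f s) - 2 • g) := by
      intro χ
      rw [Finset.prod_one_add, Finset.mul_sum]
      refine Finset.sum_congr rfl fun T _ => ?_
      rw [sub_eq_add_neg, χ.map_add_eq_mul, addChar_map_sum, mul_comm]
    simp_rw [this]
    rw [Finset.sum_comm]
    simp_rw [AddChar.sum_apply_eq_ite, sub_eq_zero]
    rw [← Finset.sum_filter, Finset.sum_const, nsmul_eq_mul, mul_comm]
  set W : ℝ := 2 ^ S.card with hW
  set e : ℝ := Real.exp (-(M / (8 * (n : ℝ) ^ 2))) with he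
  have hterm : ∀ χ : AddChar G ℂ,
      (if χ = 0 then W else 0) - W * e ≤ (χ (-(2 • g)) * ∏ s ∈ S, (1 + χ (f s))).re := by
    intro χ
    have hWe : 0 ≤ W * e := by positivity
    by_cases h0 : χ = 0
    · subst h0
      have : ((0 : AddChar G ℂ) (-(2 • g)) * ∏ s ∈ S, (1 + (0 : AddChar G ℂ) (f s))).re = W := by
        simp only [AddChar.zero_apply, one_mul, Finset.prod_const, hW]
        norm_num
        norm_cast
      rw [this, if_pos rfl]
      linarith
    rw [if_neg h0]
    rcases hχ χ with hq | hq
    -- A quadratic character is trivial at the double, and each factor `1 + χ (f s)` is `0` or `2`.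
    · have hg : χ (-(2 • g)) = 1 := by
        rw [← smul_neg, χ.map_nsmul_eq_pow, hq]
      have hnn : ∃ y : ℝ, 0 ≤ y ∧ ∏ s ∈ S, (1 + χ (f s)) = (y : ℂ) := by
        refine Finset.prod_induction _ (fun z : ℂ => ∃ y : ℝ, 0 ≤ y ∧ z = (y : ℂ)) ?_ ?_ ?_
        · rintro _ _ ⟨a, ha, rfl⟩ ⟨b, hb, rfl⟩
          exact ⟨a * b, mul_nonneg ha hb, by push_cast; rfl⟩
        · exact ⟨1, zero_le_one, by simp⟩
        · intro s _
          rcases sq_eq_one_iff.1 (hq (f s)) with h | h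
          · exact ⟨2, by norm_num, by rw [h]; norm_num⟩
          · exact ⟨0, le_rfl, by rw [h]; norm_num⟩
      obtain ⟨y, hy, hyp⟩ := hnn
      rw [hg, hyp, one_mul, Complex.ofReal_re]
      linarith
    · have hpow : ∀ x, χ x ^ n = 1 := fun x => by
        rw [← χ.map_nsmul_eq_pow, hexp, χ.map_zero_eq_one]
      have hn1 : ∀ x, ‖χ x‖ = 1 := fun x =>
        Complex.norm_eq_one_of_pow_eq_one (hpow x) hn.ne'
      have hbound : ‖χ (-(2 • g)) * ∏ s ∈ S, (1 + χ (f s))‖ ≤ W * e := by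
        rw [norm_mul, hn1, one_mul, norm_prod]
        set c : ℝ := Real.exp (-(1 / (8 * (n : ℝ) ^ 2))) with hc
        have hc1 : c ≤ 1 := by
          rw [hc, Real.exp_le_one_iff]
          have : (0 : ℝ) ≤ 1 / (8 * (n : ℝ) ^ 2) := by positivity
          linarith
        have hc0 : 0 ≤ c := by positivity
        calc ∏ s ∈ S, ‖1 + χ (f s)‖ ≤ ∏ s ∈ S, 2 * (if χ (f s) ≠ 1 then c else 1) := by
              refine Finset.prod_le_prod (fun _ _ => norm_nonneg _) fun s _ => ?_
              split_ifs with h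
              · exact norm_one_add_le_of_pow_eq_one hn (hpow _) h
              · refine (norm_add_le _ _).trans ?_
                rw [hn1, norm_one]; norm_num
          _ = W * c ^ (Finset.card {s ∈ S | χ (f s) ≠ 1}) := by
              rw [Finset.prod_mul_distrib, Finset.prod_const, ← Finset.prod_filter,
                Finset.prod_const]
          _ ≤ W * c ^ M := by
              gcongr ?_ * ?_
              exact pow_le_pow_of_le_one hc0 hc1 hq
          _ = W * e := by
              rw [hc, he, ← Real.exp_nat_mul]; congr 2; ring
      have := (abs_le.1 ((Complex.abs_re_le_norm _).trans hbound)).1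
      linarith
  have hre : (Fintype.card G : ℝ) * A.card =
      ∑ χ : AddChar G ℂ, (χ (-(2 • g)) * ∏ s ∈ S, (1 + χ (f s))).re := by
    rw [← Complex.re_sum, ← hcount]
    norm_cast
  -- The trivial character gives the main term `W`; the errors total at most `W / 2`, and `W / 2`
  -- exceeds `|G|`.
  have hsum : W - Fintype.card G * (W * e) ≤ (Fintype.card G : ℝ) * A.card := by
    rw [hre]
    refine le_trans (le_of_eq ?_) (Finset.sum_le_sum fun χ _ => hterm χ)
    rw [Finset.sum_sub_distrib, Finset.sum_ite_eq' Finset.univ (0 : AddChar G ℂ)]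
    simp
  have hG : 0 < (Fintype.card G : ℝ) := by exact_mod_cast Fintype.card_pos
  have hGe : Fintype.card G * e ≤ 1 / 2 := by
    have hpos := Real.exp_pos (M / (8 * (n : ℝ) ^ 2))
    rw [he, Real.exp_neg, ← div_eq_mul_inv, div_le_iff₀ hpos]
    linarith
  have hW0 : 0 < W := by positivity
  have : (Fintype.card G : ℝ) * 1 < Fintype.card G * A.card := by nlinarith
  have := lt_of_mul_lt_mul_left this hG.le
  exact_mod_cast this

/-! ### Balanced sets of primes contain targets. -/

/-- The subgroup on which the square of a character is trivial. -/
def sqKer {U : Type*} [CommGroup U] (χ : AddChar (Additive U) ℂ) : Subgroup U where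
  carrier := {u | χ (Additive.ofMul u) ^ 2 = 1}
  one_mem' := by simp
  mul_mem' {a b} ha hb := by
    simp only [Set.mem_ofPred_eq] at *
    rw [ofMul_mul, χ.map_add_eq_mul, mul_pow, ha, hb, one_mul]
  inv_mem' {a} ha := by
    simp only [Set.mem_ofPred_eq] at *
    rw [ofMul_inv, χ.map_neg_eq_inv, inv_pow, ha, inv_one]

theorem mem_sqKer {U : Type*} [CommGroup U] (χ : AddChar (Additive U) ℂ) (u : U) :
    u ∈ sqKer χ ↔ χ (Additive.ofMul u) ^ 2 = 1 := Iff.rfl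

/-- By Cauchy, an even index would give an element of order two in the quotient, which an odd power
cannot kill. -/
theorem odd_index_of_forall_pow_mem {U : Type*} [CommGroup U] [Finite U] {H : Subgroup U}
    {m : ℕ} (hm : Odd m) (h : ∀ u, u ^ m ∈ H) : Odd H.index := by
  rw [← Nat.not_even_iff_odd, even_iff_two_dvd]
  intro h2
  have : Fact (Nat.Prime 2) := ⟨Nat.prime_two⟩
  obtain ⟨x, hx⟩ := exists_prime_orderOf_dvd_card' (G := U ⧸ H) 2 h2
  have : x ^ m = 1 := by
    induction x using QuotientGroup.induction_on with
    | H u => rw [← QuotientGroup.mk_pow]; exact (QuotientGroup.eq_one_iff _).2 (h u)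
  have h3 := orderOf_dvd_of_pow_eq_one this
  rw [hx, ← even_iff_two_dvd] at h3
  exact (Nat.not_even_iff_odd.2 hm) h3

theorem odd_index_sqKer {U : Type*} [CommGroup U] [Finite U] {m : ℕ} (hm : Odd m)
    (hU : ∀ u : U, u ^ (2 * m) = 1) (χ : AddChar (Additive U) ℂ) : Odd (sqKer χ).index := by
  refine odd_index_of_forall_pow_mem hm fun u => ?_
  rw [mem_sqKer, ← χ.map_nsmul_eq_pow, ← ofMul_pow, ← pow_mul, mul_comm, hU]
  simp

open Classical in
/-- The elements of `S` whose residues modulo `L` lie in the coset `g • H`. -/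
noncomputable def inCoset {L : ℕ} (H : Subgroup (ZMod L)ˣ) (g : (ZMod L)ˣ) (S : Finset ℕ) : Finset ℕ :=
  {p ∈ S | ∃ u ∈ g • (H : Set (ZMod L)ˣ), (u : ZMod L) = (p : ZMod L)}

theorem inCoset_subset {L : ℕ} (H : Subgroup (ZMod L)ˣ) (g : (ZMod L)ˣ) (S : Finset ℕ) :
    inCoset H g S ⊆ S :=
  by classical exact Finset.filter_subset _ _

theorem inter_inCoset {L : ℕ} {H : Subgroup (ZMod L)ˣ} {g : (ZMod L)ˣ} {S P : Finset ℕ}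
    (h : S ⊆ P) : S ∩ inCoset H g P = inCoset H g S := by
  ext p
  simp only [inCoset, Finset.mem_inter, Finset.mem_filter]
  exact ⟨fun hp => ⟨hp.1, hp.2.2⟩, fun hp => ⟨hp.1, h hp.1, hp.2⟩⟩

/-- No coset of a proper subgroup `sqKer χ` contains half of the elements of `S`. -/
def Balanced (L : ℕ) (S : Finset ℕ) : Prop :=
  ∀ χ : AddChar (Additive (ZMod L)ˣ) ℂ, sqKer χ ≠ ⊤ → ∀ g : (ZMod L)ˣ,
    2 * (inCoset (sqKer χ) g S).card < S.card

theorem isTarget_prod {L h : ℕ} {a : ℤ} {u : (ZMod L)ˣ} {S T : Finset ℕ} (hTS : T ⊆ S)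
    (hprime : ∀ p ∈ T, p.Prime) (hT : T.Nonempty) (hu : ∏ p ∈ T, (p : ZMod L) = u)
    (ha : (T.card : ℤ) ≡ a [ZMOD h]) (hev : Even T.card) :
    IsTarget L h a u S (∏ p ∈ T, p) := by
  have hpf : (∏ p ∈ T, p).primeFactors = T := Nat.primeFactors_prod hprime
  have hω : ArithmeticFunction.cardDistinctFactors (∏ p ∈ T, p) = T.card := by
    conv_rhs => rw [← hpf]
    rw [ArithmeticFunction.cardDistinctFactors_apply, Nat.primeFactors, List.card_toFinset]
  have h0 : ∏ p ∈ T, p ≠ 0 := Finset.prod_ne_zero_iff.2 fun p hp => (hprime p hp).ne_zero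
  refine ⟨?_, ?_, ?_, ?_, ?_, ?_⟩
  · obtain ⟨p, hp⟩ := hT
    exact (hprime p hp).one_lt.trans_le
      (Nat.le_of_dvd (Nat.pos_of_ne_zero h0) (Finset.dvd_prod_of_mem _ hp))
  · refine Finset.squarefree_prod_of_pairwise_isCoprime ?_ fun p hp => (hprime p hp).squarefree
    intro p hp q hq hpq
    exact Nat.coprime_iff_isRelPrime.1 ((Nat.coprime_primes (hprime p hp) (hprime q hq)).2 hpq)
  · intro p hp hd
    refine hTS ?_
    rw [← hpf]
    exact Nat.mem_primeFactors.2 ⟨hp, hd, h0⟩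
  · rw [Nat.cast_prod, hu]
  · rw [hω]; exact ha
  · rw [hω]; exact hev

/-- The element `(p mod L, 1)` of `(ℤ/Lℤ)ˣ × ℤ/2hℤ`, with the value `0` if `p` is not
prime to `L`. -/
noncomputable def residuePair (L h p : ℕ) : Additive (ZMod L)ˣ × ZMod (2 * h) :=
  if hp : p.Coprime L then (Additive.ofMul (ZMod.unitOfCoprime p hp), 1) else 0

/-- A character of `(ℤ/Lℤ)ˣ × ℤ/2hℤ` is quadratic or nontrivial at many elements of a balanced
set. -/
theorem Balanced.char_dichotomy {L h : ℕ} [NeZero h] {S : Finset ℕ} (hS : Balanced L S)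
    (χ : AddChar (Additive (ZMod L)ˣ × ZMod (2 * h)) ℂ) :
    (∀ x, χ x ^ 2 = 1) ∨
      (Finset.card {p ∈ S | p.Coprime L}) ≤
        (Finset.card {p ∈ {p ∈ S | p.Coprime L} | χ (residuePair L h p) ≠ 1}) + S.card / 2 := by
  classical
  set ψ : AddChar (Additive (ZMod L)ˣ) ℂ := χ.compAddMonoidHom (AddMonoidHom.inl _ _) with hψ
  have hmul : ∀ u j, χ (u, j) = ψ u * χ (0, j) := fun u j => by
    rw [hψ, AddChar.compAddMonoidHom_apply, ← χ.map_add_eq_mul]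
    simp
  have hres : ∀ p (hp : p.Coprime L), χ (residuePair L h p) =
      ψ (Additive.ofMul (ZMod.unitOfCoprime p hp)) * χ (0, 1) := fun p hp => by
    rw [residuePair, dif_pos hp, hmul]
  set S' : Finset ℕ := {p ∈ S | p.Coprime L} with hS'
  have hsplit := Finset.card_filter_add_card_filter_not (s := S')
    (fun p => χ (residuePair L h p) = 1)
  suffices hsuff : (∀ x, χ x ^ 2 = 1) ∨
      2 * (Finset.card {p ∈ S' | χ (residuePair L h p) = 1}) ≤ S.card by
    refine hsuff.imp id fun h1 => ?_
    have : (Finset.card {p ∈ S' | χ (residuePair L h p) = 1}) ≤ S.card / 2 := by omega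
    simp only [ne_eq]
    omega
  by_cases htop : sqKer ψ = ⊤
  · have hψ2 : ∀ u, ψ u ^ 2 = 1 := fun u => by
      have : u.toMul ∈ sqKer ψ := by rw [htop]; trivial
      exact this
    by_cases h1 : χ (0, 1) ^ 2 = 1
    · left
      rintro ⟨u, j⟩
      have hj : ((0 : Additive (ZMod L)ˣ), j) = j.val • ((0 : Additive (ZMod L)ˣ), (1 : ZMod (2 * h))) := by
        ext <;> simp
      rw [hmul, mul_pow, hψ2, one_mul, hj, χ.map_nsmul_eq_pow, ← pow_mul, mul_comm j.val, pow_mul, h1,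
        one_pow]
    -- Here `χ² = χ (0, 1)² ≠ 1` at every `(p, 1)`, so `χ` is never trivial on the sequence.
    · right
      rw [Finset.filter_false_of_mem]
      · simp
      · intro p hp hp1
        have hc : p.Coprime L := (Finset.mem_filter.1 hp).2
        apply h1
        have := congrArg (· ^ 2) hp1
        simpa only [hres p hc, mul_pow, hψ2, one_mul, one_pow] using this
  · right
    -- All primes where `χ` is trivial share the value `ψ p = χ (0, 1)⁻¹`, so they lie in the coset
    -- of `p₀`.
    rcases Finset.eq_empty_or_nonempty ({p ∈ S' | χ (residuePair L h p) = 1}) with h0 | ⟨p₀, hp₀⟩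
    · rw [h0]; simp
    · rw [Finset.mem_filter, hS', Finset.mem_filter] at hp₀
      refine le_trans (Nat.mul_le_mul_left 2 (Finset.card_le_card ?_))
        (hS ψ htop (ZMod.unitOfCoprime p₀ hp₀.1.2)).le
      intro p hp
      rw [Finset.mem_filter, hS', Finset.mem_filter] at hp
      simp only [inCoset, Finset.mem_filter]
      refine ⟨hp.1.1, ZMod.unitOfCoprime p hp.1.2, ?_, by simp⟩
      rw [mem_leftCoset_iff, SetLike.mem_coe, mem_sqKer, ofMul_mul, ofMul_inv, ψ.map_add_eq_mul,
        ψ.map_neg_eq_inv]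
      have h1 := hp.2
      have h2 := hp₀.2
      rw [hres p hp.1.2] at h1
      rw [hres p₀ hp₀.1.2] at h2
      have h3 : χ (0, 1) ≠ 0 := right_ne_zero_of_mul_eq_one h1
      rw [mul_right_cancel₀ h3 (h1.trans h2.symm), inv_mul_cancel₀, one_pow]
      exact left_ne_zero_of_mul_eq_one h2

theorem Balanced.exists_isTarget {L h m : ℕ} (hL : L ≠ 0) (hh : 0 < h) (hm : 0 < m)
    (hU : ∀ u : (ZMod L)ˣ, u ^ (2 * m) = 1) {S : Finset ℕ} (hS : Balanced L S)
    (hprime : ∀ p ∈ S, p.Prime) (hω : 4 * L.primeFactors.card ≤ S.card)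
    (hsize : 4 * (L : ℝ) * h ≤ Real.exp (S.card / (32 * (4 * m * h : ℝ) ^ 2)))
    {a : ℤ} (ha : ∃ b : ℤ, Even b ∧ b ≡ a [ZMOD h]) {u : (ZMod L)ˣ} (hu : IsSquare u) :
    ∃ N, IsTarget L h a u S N := by
  classical
  have : NeZero L := ⟨hL⟩
  have : NeZero h := ⟨hh.ne'⟩
  obtain ⟨v, rfl⟩ := hu
  obtain ⟨_, ⟨b, rfl⟩, hba⟩ := ha
  set S' : Finset ℕ := {p ∈ S | p.Coprime L} with hS'
  have hS'card : S.card ≤ S'.card + L.primeFactors.card := by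
    have h1 : S'.card + (Finset.card {p ∈ S | ¬ p.Coprime L}) = S.card :=
      Finset.card_filter_add_card_filter_not (s := S) (fun p => p.Coprime L)
    have h2 : (Finset.card {p ∈ S | ¬ p.Coprime L}) ≤ L.primeFactors.card := by
      refine Finset.card_le_card fun p hp => ?_
      rw [Finset.mem_filter] at hp
      have hpp := hprime p hp.1
      rw [hpp.coprime_iff_not_dvd, not_not] at hp
      exact Nat.mem_primeFactors.2 ⟨hpp, hp.2, hL⟩
    omega
  have hcardG : (Fintype.card (Additive (ZMod L)ˣ × ZMod (2 * h)) : ℝ) ≤ L * (2 * h) := by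
    rw [Fintype.card_prod, ZMod.card, Fintype.card_additive, ZMod.card_units_eq_totient]
    push_cast
    have : (L.totient : ℝ) ≤ L := by exact_mod_cast L.totient_le
    gcongr
  have hh1 : (1 : ℝ) ≤ h := by exact_mod_cast hh
  have hm1 : (1 : ℝ) ≤ m := by exact_mod_cast hm
  have hL1 : (1 : ℝ) ≤ L := by exact_mod_cast Nat.one_le_iff_ne_zero.2 hL
  have hn1 : (1 : ℝ) ≤ (4 * m * h : ℝ) ^ 2 := by
    have : (1 : ℝ) ≤ 4 * m * h := by nlinarith [mul_nonneg (sub_nonneg.2 hm1) (sub_nonneg.2 hh1)]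
    nlinarith
  have hr1 : Real.exp (S.card / (32 * (4 * m * h : ℝ) ^ 2)) < 2 ^ S'.card := by
    have hpos : 1 < Real.exp (S.card / (32 * (4 * m * h : ℝ) ^ 2)) := by
      refine lt_of_lt_of_le ?_ hsize
      nlinarith [mul_nonneg (sub_nonneg.2 hL1) (sub_nonneg.2 hh1)]
    have hSpos : (0 : ℝ) < S.card := by
      rw [Real.one_lt_exp_iff] at hpos
      by_contra h0
      have h0' : (S.card : ℝ) = 0 := le_antisymm (not_lt.1 h0) (Nat.cast_nonneg _)
      rw [h0', zero_div] at hpos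
      exact lt_irrefl _ hpos
    have h34 : (3 : ℝ) * S.card ≤ 4 * S'.card := by
      have : 3 * S.card ≤ 4 * S'.card := by omega
      exact_mod_cast this
    have h2 : (2 : ℝ) ^ S'.card = Real.exp (S'.card * Real.log 2) := by
      rw [Real.exp_nat_mul, Real.exp_log (by norm_num)]
    rw [h2, Real.exp_lt_exp]
    have hlog : (0.5 : ℝ) ≤ Real.log 2 := by linarith [Real.log_two_gt_d9]
    calc (S.card : ℝ) / (32 * (4 * m * h : ℝ) ^ 2) ≤ S.card / 32 := by
          apply div_le_div_of_nonneg_left hSpos.le (by norm_num); linarith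
      _ < S'.card * 0.5 := by linarith
      _ ≤ _ := by gcongr
  obtain ⟨T, hTS, hT, hsum⟩ : ∃ T ⊆ S', T.Nonempty ∧ ∑ p ∈ T, residuePair L h p =
      2 • ((Additive.ofMul v, (b : ZMod (2 * h))) : Additive (ZMod L)ˣ × ZMod (2 * h)) := by
    refine exists_subset_sum_eq S' (residuePair L h)
      -- `4mh = 2m · 2h` kills both factors. `M` is `|S| / 4` rounded up: at least `3/4` of `S` is
      -- prime to `L`, and `χ` is trivial on at most half of `S`.
      (Additive.ofMul v, (b : ZMod (2 * h))) (n := 4 * m * h) (M := (S.card + 3) / 4)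
      (Nat.mul_pos (Nat.mul_pos (by norm_num) hm) hh) ?_ ?_ ?_ ?_
    · rintro ⟨x, j⟩
      have hx : (4 * m * h) • x = 0 := by
        have h0 : (2 * m) • x = 0 := hU x.toMul
        rw [show 4 * m * h = (2 * h) * (2 * m) by ring, mul_smul, h0, smul_zero]
      have hj : (4 * m * h) • j = 0 := by
        rw [show 4 * m * h = (2 * m) * (2 * h) by ring, mul_smul,
          ← Nat.cast_smul_eq_nsmul (ZMod (2 * h)) (2 * h), ZMod.natCast_self, zero_smul, smul_zero]
      rw [Prod.smul_mk, hx, hj]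
      rfl
    · intro χ
      refine (hS.char_dichotomy χ).imp id fun h1 => ?_
      rw [← hS'] at h1
      omega
    · refine le_trans ?_ (hsize.trans (Real.exp_le_exp.2 ?_))
      · linarith
      · have h4 : (S.card : ℝ) ≤ 4 * ((S.card + 3) / 4 : ℕ) := by
          have : S.card ≤ 4 * ((S.card + 3) / 4) := by omega
          exact_mod_cast this
        push_cast at h4 ⊢
        rw [div_le_div_iff₀ (by positivity) (by positivity)]
        nlinarith
    · refine lt_of_le_of_lt ?_ hr1
      refine le_trans ?_ hsize
      linarith
  have hcop : ∀ p ∈ T, p.Coprime L := fun p hp => (Finset.mem_filter.1 (hTS hp)).2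
  have h1 : ∏ p ∈ T, (p : ZMod L) = ((v * v : (ZMod L)ˣ) : ZMod L) := by
    have := congrArg (fun x => ((Additive.toMul x.1 : (ZMod L)ˣ) : ZMod L)) hsum
    simp only [Prod.fst_sum, toMul_sum, Units.coe_prod, Prod.smul_fst, toMul_nsmul,
      toMul_ofMul] at this
    rw [← pow_two, ← this]
    refine Finset.prod_congr rfl fun p hp => ?_
    rw [residuePair, dif_pos (hcop p hp)]
    simp
  have h2 : (T.card : ℤ) ≡ b + b [ZMOD (2 * h : ℕ)] := by
    rw [← ZMod.intCast_eq_intCast_iff]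
    have := congrArg Prod.snd hsum
    rw [Prod.snd_sum, Finset.sum_congr rfl (g := fun _ => (1 : ZMod (2 * h)))] at this
    · simpa [two_mul] using this
    · intro p hp
      rw [residuePair, dif_pos (hcop p hp)]
  refine ⟨_, isTarget_prod (hTS.trans (Finset.filter_subset _ _))
    (fun p hp => hprime p (Finset.mem_filter.1 (hTS hp)).1) hT h1 ?_ ?_⟩
  · refine Int.ModEq.trans (h2.of_dvd ?_) hba
    push_cast
    exact dvd_mul_left _ _
  · have h3 : (T.card : ℤ) ≡ b + b [ZMOD 2] := h2.of_dvd (by push_cast; exact dvd_mul_right _ _)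
    rw [← Int.even_coe_nat, Int.even_iff, h3, ← Int.even_iff]
    exact ⟨b, rfl⟩

/-! ### Most subsets are balanced. -/

open Classical in
theorem card_not_balanced_le {L : ℕ} [NeZero L] {P : Finset ℕ}
    (hP : ∀ χ : AddChar (Additive (ZMod L)ˣ) ℂ, sqKer χ ≠ ⊤ → ∀ g : (ZMod L)ˣ,
      16 * (inCoset (sqKer χ) g P).card ≤ P.card) (r : ℕ) :
    (Finset.card {S ∈ P.powersetCard r | ¬ Balanced L S}) * 2 ^ r ≤
      L ^ 2 * (P.powersetCard r).card := by
  set B : AddChar (Additive (ZMod L)ˣ) ℂ × (ZMod L)ˣ → Finset (Finset ℕ) := fun x =>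
    if sqKer x.1 = ⊤ then ∅ else
      {S ∈ P.powersetCard r | r ≤ 2 * (S ∩ inCoset (sqKer x.1) x.2 P).card} with hB
  have hsub : ({S ∈ P.powersetCard r | ¬ Balanced L S} : Finset (Finset ℕ)) ⊆
      Finset.univ.biUnion B := by
    intro S hS
    rw [Finset.mem_filter] at hS
    obtain ⟨hS, hnb⟩ := hS
    have hS' := Finset.mem_powersetCard.1 hS
    simp only [Balanced, not_forall, not_lt] at hnb
    obtain ⟨χ, hχ, g, hg⟩ := hnb
    rw [Finset.mem_biUnion]
    refine ⟨(χ, g), Finset.mem_univ _, ?_⟩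
    simp only [hB, if_neg hχ, Finset.mem_filter]
    refine ⟨hS, ?_⟩
    rw [inter_inCoset hS'.1, ← hS'.2]
    exact hg
  have hBcard : ∀ x, (B x).card * 2 ^ r ≤ (P.powersetCard r).card := by
    intro x
    by_cases hx : sqKer x.1 = ⊤
    · simp [hB, hx]
    · simp only [hB, if_neg hx]
      exact card_half_inter_mul_two_pow_le (inCoset_subset _ _ _) (hP x.1 hx x.2) r
  calc (Finset.card {S ∈ P.powersetCard r | ¬ Balanced L S}) * 2 ^ r
      ≤ (∑ x, (B x).card) * 2 ^ r :=
        Nat.mul_le_mul_right _ ((Finset.card_le_card hsub).trans Finset.card_biUnion_le)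
    _ = ∑ x, (B x).card * 2 ^ r := Finset.sum_mul _ _ _
    _ ≤ ∑ _x : AddChar (Additive (ZMod L)ˣ) ℂ × (ZMod L)ˣ, (P.powersetCard r).card :=
        Finset.sum_le_sum fun x _ => hBcard x
    _ ≤ L ^ 2 * (P.powersetCard r).card := by
        rw [Finset.sum_const, Finset.card_univ, Fintype.card_prod, smul_eq_mul, pow_two]
        have h1 : Fintype.card (ZMod L)ˣ ≤ L := by
          rw [ZMod.card_units_eq_totient]; exact L.totient_le
        have h2 : Fintype.card (AddChar (Additive (ZMod L)ˣ) ℂ) ≤ L := by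
          rw [AddChar.card_eq, Fintype.card_additive]
          exact h1
        gcongr

/-! ### The exponent of the unit group and the size of `L`. -/

/-- Half of a multiple of all `q - 1`, for the primes `q ∣ L`, when these are square-free and have
no odd prime factor greater than `y`. -/
noncomputable def oddModulus (L y : ℕ) : ℕ :=
  ∏ p ∈ Finset.range (y + 1) with p.Prime ∧ 1 < part L p ∧ p ≠ 2, p

theorem odd_oddModulus (L y : ℕ) : Odd (oddModulus L y) := by
  refine Finset.prod_induction _ Odd (fun _ _ => Odd.mul) odd_one fun p hp => ?_
  rw [Finset.mem_filter] at hp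
  exact hp.2.1.odd_of_ne_two hp.2.2.2

theorem one_lt_part {L p q : ℕ} (hq : q ∈ L.primeFactors) (hp : p ∣ q - 1) : 1 < part L p := by
  have hmem : q ∈ ({q ∈ L.primeFactors | p ∣ q - 1} : Finset ℕ) := Finset.mem_filter.2 ⟨hq, hp⟩
  have hpos : 0 < part L p := Finset.prod_pos fun i hi =>
    (Nat.prime_of_mem_primeFactors (Finset.mem_filter.1 hi).1).pos
  exact (Nat.prime_of_mem_primeFactors hq).one_lt.trans_le
    (Nat.le_of_dvd hpos (Finset.dvd_prod_of_mem (fun q => q) hmem))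

/-- Fermat's little theorem modulo each prime factor of the square-free `L`. -/
theorem pow_eq_one_of_sub_one_dvd {L n : ℕ} [NeZero L] (hL : Squarefree L)
    (h : ∀ q ∈ L.primeFactors, q - 1 ∣ n) (u : (ZMod L)ˣ) : u ^ n = 1 := by
  set a := (u : ZMod L).val with ha
  have hau : (a : ZMod L) = u := ZMod.natCast_zmod_val _
  have hcop : a.Coprime L := ZMod.val_coe_unit_coprime u
  have hdvd : (L : ℤ) ∣ (a : ℤ) ^ n - 1 := by
    rw [Int.natCast_dvd, ← Nat.prod_primeFactors_of_squarefree hL]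
    refine Finset.prod_primes_dvd _ (fun q hq => (Nat.prime_of_mem_primeFactors hq).prime)
      fun q hq => ?_
    have hqp := Nat.prime_of_mem_primeFactors hq
    have : Fact q.Prime := ⟨hqp⟩
    rw [← Int.natCast_dvd, ← ZMod.intCast_zmod_eq_zero_iff_dvd]
    push_cast
    obtain ⟨t, ht⟩ := h q hq
    have hne : (a : ZMod q) ≠ 0 := by
      rw [Ne, ZMod.natCast_eq_zero_iff]
      intro hd
      exact hqp.one_lt.ne' (Nat.dvd_one.1 (hcop ▸ Nat.dvd_gcd hd (Nat.dvd_of_mem_primeFactors hq)))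
    rw [ht, pow_mul, ZMod.pow_card_sub_one_eq_one hne, one_pow, sub_self]
  rw [← ZMod.intCast_zmod_eq_zero_iff_dvd] at hdvd
  push_cast at hdvd
  ext
  rw [Units.val_pow_eq_pow_val, ← hau, Units.val_one]
  exact sub_eq_zero.1 hdvd

theorem card_primeFactors_le {L n : ℕ} (h : ∀ q ∈ L.primeFactors, q - 1 ∣ n) (hn : n ≠ 0) :
    L.primeFactors.card ≤ n := by
  refine le_trans ?_ n.card_divisors_le_self
  refine Finset.card_le_card_of_injOn (fun q => q - 1)
    (fun q hq => Nat.mem_divisors.2 ⟨h q hq, hn⟩) ?_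
  intro p hp q hq hpq
  have h1 := (Nat.prime_of_mem_primeFactors hp).one_lt
  have h2 := (Nat.prime_of_mem_primeFactors hq).one_lt
  simp only at hpq
  omega

/-- `L` is a product of at most `n` primes, each at most `n + 1`. -/
theorem le_exp_sq {L n : ℕ} (hL : Squarefree L) (h : ∀ q ∈ L.primeFactors, q - 1 ∣ n)
    (hn : n ≠ 0) : (L : ℝ) ≤ Real.exp ((n : ℝ) ^ 2) := by
  have h1 : L ≤ (n + 1) ^ n := by
    conv_lhs => rw [← Nat.prod_primeFactors_of_squarefree hL]
    refine (Finset.prod_le_pow_card _ _ (n + 1) fun q hq => ?_).trans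
      (Nat.pow_le_pow_right (Nat.succ_pos _) (card_primeFactors_le h hn))
    have := Nat.le_of_dvd (Nat.pos_of_ne_zero hn) (h q hq)
    omega
  calc (L : ℝ) ≤ ((n : ℝ) + 1) ^ n := by exact_mod_cast h1
    _ ≤ Real.exp n ^ n := pow_le_pow_left₀ (by positivity) (Real.add_one_le_exp _) _
    _ = _ := by rw [← Real.exp_nat_mul]; congr 1; ring

/-! ### Size estimates for the construction. -/

namespace Params

variable {c : Params} {δ K : ℝ}

theorem IsModulus.sub_one_dvd (hc : c.IsModulus δ K) {q : ℕ} (hq : q ∈ c.L.primeFactors) :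
    q - 1 ∣ 2 * oddModulus c.L c.y₅ := by
  have h2 : 2 * oddModulus c.L c.y₅ = ∏ p ∈ insert 2 (Finset.filter
      (fun p => p.Prime ∧ 1 < part c.L p ∧ p ≠ 2) (Finset.range (c.y₅ + 1))), p := by
    rw [Finset.prod_insert (by simp)]; rfl
  rw [← Nat.prod_primeFactors_of_squarefree (hc.pred_squarefree q hq), h2]
  refine Finset.prod_dvd_prod_of_subset _ _ _ fun p hp => ?_
  have hpp := Nat.prime_of_mem_primeFactors hp
  have hpart := one_lt_part hq (Nat.dvd_of_mem_primeFactors hp)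
  rw [Finset.mem_insert, Finset.mem_filter, Finset.mem_range]
  rcases hc.part_range p hpp hpart with h | h
  · exact Or.inl h
  · by_cases hp2 : p = 2
    · exact Or.inl hp2
    · exact Or.inr ⟨Nat.lt_succ_of_le (by exact_mod_cast h.2), hpp, hpart, hp2⟩

/-- At most `K * y₂` primes enter the product, each at most `y₅`. -/
theorem IsModulus.oddModulus_le (hc : c.IsModulus δ K) (hy : 1 ≤ c.y₅) :
    (oddModulus c.L c.y₅ : ℝ) ≤ (c.y₅ : ℝ) ^ (K * c.y₂) := by
  set T : Finset ℕ := {p ∈ Finset.range (c.y₅ + 1) | p.Prime ∧ 1 < part c.L p ∧ p ≠ 2} with hT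
  have hfin : {p : ℕ | p.Prime ∧ 1 < part c.L p}.Finite := by
    refine (Set.finite_Iic (max 2 c.y₅)).subset fun p hp => ?_
    rcases hc.part_range p hp.1 hp.2 with h | h
    · exact Set.mem_Iic.2 (h ▸ le_max_left _ _)
    · exact Set.mem_Iic.2 (le_trans (by exact_mod_cast h.2) (le_max_right _ _))
  have hcard : (T.card : ℝ) ≤ K * c.y₂ := by
    refine le_trans ?_ hc.part_count
    have hsub : (T : Set ℕ) ⊆ {p : ℕ | p.Prime ∧ 1 < part c.L p} := fun p hp => by
      have := (Finset.mem_filter.1 (Finset.mem_coe.1 hp)).2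
      exact ⟨this.1, this.2.1⟩
    have hle := Set.ncard_le_ncard hsub hfin
    rw [Set.ncard_coe_finset] at hle
    exact_mod_cast hle
  have h1 : oddModulus c.L c.y₅ ≤ c.y₅ ^ T.card :=
    Finset.prod_le_pow_card _ _ _ fun p hp => by
      have := Finset.mem_range.1 (Finset.mem_filter.1 hp).1
      omega
  calc (oddModulus c.L c.y₅ : ℝ) ≤ (c.y₅ : ℝ) ^ (T.card : ℝ) := by
        rw [Real.rpow_natCast]; exact_mod_cast h1
    _ ≤ _ := Real.rpow_le_rpow_of_exponent_le (by exact_mod_cast hy) hcard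

theorem IsModulus.y₂_rpow_le_w (hc : c.IsModulus δ K) (hy : 2 ≤ c.y₅) :
    c.y₂ ^ (1 + δ) ≤ c.w := by
  have hy5 : (1 : ℝ) < c.y₅ := by exact_mod_cast hy
  have hy2 : 1 < c.y₂ := by
    rw [hc.y₂_eq]; exact Real.one_lt_rpow hy5 (by norm_num)
  have hchain := hc.spread.2
  simp only [List.isChain_cons_cons] at hchain
  have h1 := hchain.2.1.1
  rw [le_div_iff₀ (Real.log_pos hy2)] at h1
  rwa [Real.rpow_le_iff_le_log (by linarith) (by exact_mod_cast hc.w_pos)]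

theorem IsModulus.log_y₅_le_log_x (hc : c.IsModulus δ K) (hy : 1 ≤ c.y₅) :
    Real.log c.y₅ ≤ Real.log c.x := by
  have hy5 : (1 : ℝ) ≤ c.y₅ := by exact_mod_cast hy
  rw [x, Real.log_rpow (by linarith)]
  refine le_mul_of_one_le_left (Real.log_nonneg hy5) ?_
  rw [le_div_iff₀ (by norm_num)]
  have : (1 : ℝ) ≤ c.w := by exact_mod_cast hc.w_pos
  linarith [show (1 : ℝ) * (1 / 6 - 3 / 1000) ≤ 1 by norm_num]

/-- The size `r` dominates any fixed multiple of the eighth power of `λ(L)`. -/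
theorem eventually_mul_oddModulus_pow_le_r (δ K B : ℝ) (hδ : 0 < δ) (hB : 0 ≤ B) :
    ∀ᶠ y : ℕ in Filter.atTop, ∀ c : Params, c.y₅ = y → c.IsModulus δ K →
      B * (oddModulus c.L c.y₅ : ℝ) ^ 8 ≤ c.r := by
  set K₁ := max K 0 with hK₁
  have hK0 : 0 ≤ K₁ := le_max_right _ _
  have hy : Filter.Tendsto (fun y : ℕ => ((y : ℝ) ^ (1 / 6 - 1 / 500 : ℝ)) ^ δ)
      Filter.atTop Filter.atTop :=
    (tendsto_rpow_atTop hδ).comp ((tendsto_rpow_atTop (by norm_num)).comp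
      tendsto_natCast_atTop_atTop)
  filter_upwards [hy.eventually_ge_atTop ((8 * K₁ + 1) ^ 2), Filter.eventually_ge_atTop 2,
    (tendsto_natCast_atTop_atTop (R := ℝ)).eventually_ge_atTop (B + 1)] with y h1 h2 h3 c hcy hc
  subst hcy
  have hy5 : (1 : ℝ) < c.y₅ := by exact_mod_cast h2
  have hy2 : 1 < c.y₂ := by
    rw [hc.y₂_eq]; exact Real.one_lt_rpow hy5 (by norm_num)
  rw [← hc.y₂_eq] at h1
  have hw := hc.y₂_rpow_le_w h2
  rw [Real.rpow_add (by linarith), Real.rpow_one] at hw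
  -- Since `w ≥ y₂ ^ (1 + δ)`, the root is at least `y₂ ^ (1 + δ/2)`. The spare `1` yields a factor
  -- `y₅`, which covers `B` and the floor.
  have hsqrt : 8 * (K₁ * c.y₂) + 1 ≤ Real.sqrt (c.y₂ * c.w) := by
    have : (8 * K₁ + 1) * c.y₂ ≤ Real.sqrt (c.y₂ * c.w) := by
      refine Real.le_sqrt_of_sq_le ?_
      calc ((8 * K₁ + 1) * c.y₂) ^ 2 = c.y₂ * (c.y₂ * (8 * K₁ + 1) ^ 2) := by ring
        _ ≤ c.y₂ * (c.y₂ * c.y₂ ^ δ) := by gcongr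
        _ ≤ _ := by gcongr
    linarith
  have hm : (oddModulus c.L c.y₅ : ℝ) ≤ (c.y₅ : ℝ) ^ (K₁ * c.y₂) := by
    refine (hc.oddModulus_le (by omega)).trans
      (Real.rpow_le_rpow_of_exponent_le hy5.le ?_)
    exact mul_le_mul_of_nonneg_right (le_max_left _ _) (by linarith)
  set X : ℝ := (c.y₅ : ℝ) ^ (8 * (K₁ * c.y₂)) with hX
  have hX1 : 1 ≤ X := Real.one_le_rpow hy5.le (by positivity)
  have hm8 : (oddModulus c.L c.y₅ : ℝ) ^ 8 ≤ X := by
    refine (pow_le_pow_left₀ (Nat.cast_nonneg _) hm 8).trans (le_of_eq ?_)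
    rw [← Real.rpow_natCast, ← Real.rpow_mul (by linarith), hX]
    congr 1; push_cast; ring
  have hr : X * c.y₅ ≤ (c.y₅ : ℝ) ^ Real.sqrt (c.y₂ * c.w) := by
    calc X * c.y₅ = (c.y₅ : ℝ) ^ (8 * (K₁ * c.y₂) + 1) := by
          rw [Real.rpow_add (by linarith), Real.rpow_one]
      _ ≤ _ := Real.rpow_le_rpow_of_exponent_le hy5.le hsqrt
  have hfl := Nat.lt_floor_add_one ((c.y₅ : ℝ) ^ Real.sqrt (c.y₂ * c.w))
  have hrdef : (c.r : ℝ) = ⌊(c.y₅ : ℝ) ^ Real.sqrt (c.y₂ * (c.w : ℝ))⌋₊ := rfl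
  have hBm : B * (oddModulus c.L c.y₅ : ℝ) ^ 8 ≤ B * X := mul_le_mul_of_nonneg_left hm8 hB
  nlinarith

/-- A coset of a proper subgroup of odd index contains at most one in sixteen of the primes. -/
theorem IsConstruction.card_inCoset_le (hc : c.IsConstruction δ K)
    (hy : Real.exp (Real.exp 64) ≤ c.y₅) {H : Subgroup (ZMod c.L)ˣ} (hH : H ≠ ⊤)
    (hodd : Odd H.index) (g : (ZMod c.L)ˣ) :
    16 * (inCoset H g c.P).card ≤ c.P.card := by
  classical
  have hy1 : 1 ≤ c.y₅ := by
    have : (0 : ℝ) < c.y₅ := (Real.exp_pos _).trans_le hy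
    exact_mod_cast this
  have hlog : Real.exp 64 ≤ Real.log c.x :=
    ((Real.le_log_iff_exp_le (by exact_mod_cast hy1)).2 hy).trans (hc.log_y₅_le_log_x hy1)
  have hlog0 : 0 < Real.log c.x := (Real.exp_pos _).trans_le hlog
  have hloglog : 64 ≤ Real.log (Real.log c.x) := (Real.le_log_iff_exp_le hlog0).2 hlog
  have hgood := hc.k_good
  simp only [badMultipliers, Set.mem_ofPred_eq, not_exists, not_and, not_le] at hgood
  have h1 := hgood H hH hodd g
  have h2 : (inCoset H g c.P).card ≤
      (Finset.card {d ∈ c.D' | (d * c.k + 1).Prime ∧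
        ∃ u ∈ g • (H : Set (ZMod c.L)ˣ), (u : ZMod c.L) = ((d * c.k + 1 : ℕ) : ZMod c.L)}) := by
    refine le_trans (Finset.card_le_card (t := Finset.image (fun d => d * c.k + 1) _) ?_)
      Finset.card_image_le
    intro p hp
    simp only [inCoset, P, Finset.mem_filter, Finset.mem_image] at hp
    obtain ⟨⟨⟨d, hd, rfl⟩, hprime⟩, hu⟩ := hp
    exact Finset.mem_image.2 ⟨d, Finset.mem_filter.2 ⟨hd, hprime, hu⟩, rfl⟩
  have h3 : ((inCoset H g c.P).card : ℝ) ≤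
      (c.D.card : ℝ) / (Real.log c.x * Real.log (Real.log c.x)) := by
    refine (Nat.cast_le.2 h2).trans (le_of_lt ?_)
    convert! h1
  -- `64 = 4 · 16`: the `4` comes from the lower bound for `|𝓟|`, the `16` from the density wanted.
  have h4 : (c.D.card : ℝ) / (Real.log c.x * Real.log (Real.log c.x)) ≤
      c.D.card / (Real.log c.x * 64) := by gcongr
  have h5 : (c.D.card : ℝ) / (Real.log c.x * 64) = c.D.card / (4 * Real.log c.x) / 16 := by
    rw [div_div]; congr 1; ring
  have h6 : 16 * ((inCoset H g c.P).card : ℝ) ≤ c.P.card := by linarith [hc.card_P]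
  exact_mod_cast h6

end Params

end CarmichaelConstruction

/-! ### Assembly. -/

open Classical in
theorem mainTheorem3 (δ K C ε : ℝ) (hδ : 0 < δ) (hε : 0 < ε) :
    ∃ Y : ℕ, ∀ c : CarmichaelConstruction.Params, Y ≤ c.y₅ → c.IsConstruction δ K →
      ∀ (h : ℕ) (a : ℤ), 0 < h →
        (h : ℝ) ≤ C * (ArithmeticFunction.carmichael c.L : ℝ) ^ 2 →
        (∃ m : ℤ, Even m ∧ m ≡ a [ZMOD (h : ℤ)]) →
        ∀ u : (ZMod c.L)ˣ, IsSquare u →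
          (Finset.card {S ∈ c.P.powersetCard c.r |
              ¬ ∃ N : ℕ, CarmichaelConstruction.IsTarget c.L h a u S N} : ℝ) ≤
            ε * ((c.P.powersetCard c.r).card : ℝ) := by
  set C₁ := max C 1 with hC₁
  have hC1 : 1 ≤ C₁ := le_max_right _ _
  obtain ⟨Y, hY⟩ := Filter.eventually_atTop.1
    ((CarmichaelConstruction.Params.eventually_mul_oddModulus_pow_le_r δ K
      -- `81920 = 10 · 32 · 16²` is what the subset-sum criterion costs once `h ≤ 4 C₁ m²`; `2 / ε`
      -- makes `2 ^ r` exceed `L² / ε`.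
      (81920 * C₁ ^ 3 + 2 / ε) hδ (by positivity)).and
      ((tendsto_natCast_atTop_atTop (R := ℝ)).eventually_ge_atTop (Real.exp (Real.exp 64))))
  refine ⟨Y, fun c hYc hc h a hh hhC ha u hu => ?_⟩
  obtain ⟨hr, hy⟩ := hY c.y₅ hYc
  replace hr := hr c rfl hc.toIsModulus
  set m := CarmichaelConstruction.oddModulus c.L c.y₅ with hm
  have hmodd : Odd m := CarmichaelConstruction.odd_oddModulus _ _
  have hm0 : 0 < m := hmodd.pos
  have hm1 : (1 : ℝ) ≤ m := by exact_mod_cast hm0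
  have hL : c.L ≠ 0 := hc.squarefree.ne_zero
  have : NeZero c.L := ⟨hL⟩
  have hdvd : ∀ q ∈ c.L.primeFactors, q - 1 ∣ 2 * m := fun q hq => hc.sub_one_dvd hq
  have hU : ∀ v : (ZMod c.L)ˣ, v ^ (2 * m) = 1 :=
    CarmichaelConstruction.pow_eq_one_of_sub_one_dvd hc.squarefree hdvd
  have hLexp : (c.L : ℝ) ≤ Real.exp (4 * (m : ℝ) ^ 2) := by
    refine (CarmichaelConstruction.le_exp_sq hc.squarefree hdvd (by omega)).trans (le_of_eq ?_)
    push_cast; congr 1; ring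
  have hhm : (h : ℝ) ≤ 4 * C₁ * (m : ℝ) ^ 2 := by
    have hlam : (ArithmeticFunction.carmichael c.L : ℝ) ≤ 2 * m := by
      have : ArithmeticFunction.carmichael c.L ≤ 2 * m := by
        rw [ArithmeticFunction.carmichael_eq_exponent hL]
        exact Nat.le_of_dvd (by omega) (Monoid.exponent_dvd_of_forall_pow_eq_one hU)
      exact_mod_cast this
    calc (h : ℝ) ≤ C * (ArithmeticFunction.carmichael c.L : ℝ) ^ 2 := hhC
      _ ≤ C₁ * (2 * m) ^ 2 := by
          gcongr
          exact le_max_left _ _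
      _ = _ := by ring
  have hm28 : (m : ℝ) ^ 2 ≤ (m : ℝ) ^ 8 := pow_le_pow_right₀ hm1 (by norm_num)
  have hm18 : (m : ℝ) ≤ (m : ℝ) ^ 8 := le_self_pow₀ hm1 (by norm_num)
  have hm8 : (1 : ℝ) ≤ (m : ℝ) ^ 8 := one_le_pow₀ hm1
  have hC3 : 1 ≤ C₁ ^ 3 := one_le_pow₀ hC1
  have hε' : 0 < 2 / ε := by positivity
  have hω : 4 * c.L.primeFactors.card ≤ c.r := by
    have h1 := CarmichaelConstruction.card_primeFactors_le hdvd (by omega)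
    have h2 : (8 : ℝ) * m ≤ c.r := by nlinarith
    have h3 : 8 * m ≤ c.r := by exact_mod_cast h2
    omega
  have hsize : 4 * (c.L : ℝ) * h ≤ Real.exp (c.r / (32 * (4 * m * h : ℝ) ^ 2)) := by
    have h4 : (4 : ℝ) ≤ Real.exp (2 * (m : ℝ) ^ 2) := by
      have h41 : (4 : ℝ) ≤ Real.exp 2 := by
        rw [show (2 : ℝ) = 1 + 1 by norm_num, Real.exp_add]
        nlinarith [Real.exp_one_gt_d9]
      refine h41.trans (Real.exp_le_exp.2 ?_)
      nlinarith
    have hhexp : (h : ℝ) ≤ Real.exp (4 * C₁ * (m : ℝ) ^ 2) := by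
      linarith [Real.add_one_le_exp (4 * C₁ * (m : ℝ) ^ 2)]
    have hh1 : (1 : ℝ) ≤ h := by exact_mod_cast hh
    calc 4 * (c.L : ℝ) * h ≤ Real.exp (2 * (m : ℝ) ^ 2) * Real.exp (4 * (m : ℝ) ^ 2) *
          Real.exp (4 * C₁ * (m : ℝ) ^ 2) := by gcongr
      _ = Real.exp (2 * (m : ℝ) ^ 2 + 4 * (m : ℝ) ^ 2 + 4 * C₁ * (m : ℝ) ^ 2) := by
          rw [Real.exp_add, Real.exp_add]
      _ ≤ _ := by
          refine Real.exp_le_exp.2 ?_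
          rw [le_div_iff₀ (by positivity)]
          calc (2 * (m : ℝ) ^ 2 + 4 * (m : ℝ) ^ 2 + 4 * C₁ * (m : ℝ) ^ 2) *
                (32 * (4 * m * h : ℝ) ^ 2)
              ≤ (10 * C₁ * (m : ℝ) ^ 2) * (32 * (4 * m * (4 * C₁ * (m : ℝ) ^ 2)) ^ 2) := by
                gcongr
                nlinarith [sq_nonneg (m : ℝ)]
            _ = 81920 * C₁ ^ 3 * (m : ℝ) ^ 8 := by ring
            _ ≤ (81920 * C₁ ^ 3 + 2 / ε) * (m : ℝ) ^ 8 := by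
                gcongr
                linarith
            _ ≤ c.r := hr
  have hLε : (c.L : ℝ) ^ 2 ≤ ε * 2 ^ c.r := by
    have hε1 : 1 / ε ≤ Real.exp (1 / ε) := by linarith [Real.add_one_le_exp (1 / ε)]
    have h2r : Real.exp (c.r / 2) ≤ (2 : ℝ) ^ c.r := by
      have : (2 : ℝ) ^ c.r = Real.exp (c.r * Real.log 2) := by
        rw [Real.exp_nat_mul, Real.exp_log (by norm_num)]
      rw [this, Real.exp_le_exp]
      nlinarith [Real.log_two_gt_d9, (Nat.cast_nonneg c.r : (0 : ℝ) ≤ c.r)]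
    have hexp : Real.exp (8 * (m : ℝ) ^ 2 + 1 / ε) ≤ Real.exp (c.r / 2) := by
      refine Real.exp_le_exp.2 ?_
      have : 2 / ε = 2 * (1 / ε) := by ring
      nlinarith
    calc (c.L : ℝ) ^ 2 ≤ Real.exp (4 * (m : ℝ) ^ 2) ^ 2 := by gcongr
      _ = ε * (Real.exp (8 * (m : ℝ) ^ 2) * (1 / ε)) := by
          rw [← Real.exp_nat_mul]; field_simp; congr 1; push_cast; ring
      _ ≤ ε * (Real.exp (8 * (m : ℝ) ^ 2) * Real.exp (1 / ε)) := by gcongr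
      _ = ε * Real.exp (8 * (m : ℝ) ^ 2 + 1 / ε) := by rw [Real.exp_add]
      _ ≤ ε * 2 ^ c.r := by gcongr; exact hexp.trans h2r
  have hbal := CarmichaelConstruction.card_not_balanced_le (L := c.L) (P := c.P)
    (fun χ hχ g => hc.card_inCoset_le hy hχ
      (CarmichaelConstruction.odd_index_sqKer hmodd hU χ) g) c.r
  have hle : (Finset.card {S ∈ c.P.powersetCard c.r |
      ¬ ∃ N : ℕ, CarmichaelConstruction.IsTarget c.L h a u S N}) ≤
      (Finset.card {S ∈ c.P.powersetCard c.r | ¬ CarmichaelConstruction.Balanced c.L S}) := by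
    refine Finset.card_le_card fun S hS => ?_
    rw [Finset.mem_filter] at hS ⊢
    refine ⟨hS.1, fun hb => hS.2 ?_⟩
    obtain ⟨hSP, hSr⟩ := Finset.mem_powersetCard.1 hS.1
    exact hb.exists_isTarget hL hh hm0 hU
      (fun p hp => (Finset.mem_filter.1 (hSP hp)).2) (hSr ▸ hω) (hSr ▸ hsize) ha hu
  have hbal' : ((Finset.card {S ∈ c.P.powersetCard c.r |
      ¬ CarmichaelConstruction.Balanced c.L S}) : ℝ) * 2 ^ c.r ≤
      (c.L : ℝ) ^ 2 * (c.P.powersetCard c.r).card := by exact_mod_cast hbal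
  refine (Nat.cast_le.2 hle).trans ?_
  refine le_of_mul_le_mul_right (hbal'.trans ?_) (by positivity : (0 : ℝ) < 2 ^ c.r)
  calc (c.L : ℝ) ^ 2 * (c.P.powersetCard c.r).card
      ≤ (ε * 2 ^ c.r) * (c.P.powersetCard c.r).card := by gcongr
    _ = _ := by ring
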